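/- For a partition $\lambda$ let $\ell(\lambda)$ be its number of parts and $\sigma(\lambda)$ the sum of its parts (both $0$ for the empty partition). Its crank $c(\lambda)$ is the largest part of $\lambda$ (with $c(\emptyset)=0$) if $\lambda$ has no part equal to $1$; otherwise $c(\lambda)=\mu(\lambda)-n_1(\lambda)$, where $n_1(\lambda)$ is the number of $1$'s in $\lambda$ and $\mu(\lambda)$ is the number of parts of $\lambda$ larger than $n_1(\lambda)$. Let $\mathcal{P}^*$ be the set of all partitions together with two additional copies $1^*$, $1^{**}$ of the partition $1$. For $\lambda\in\mathcal{P}^*$ put $wt^*(\lambda)=-1$ if $\lambda=1$ and $wt^*(\lambda)=1$ otherwise; $c^*(1)=0$, $c^*(1^*)=1$, $c^*(1^{**})=-1$ and $c^*(\lambda)=c(\lambda)$ otherwise; $\sigma^*(1^*)=\sigma^*(1^{**})=1$ and $\sigma^*(\lambda)=\sigma(\lambda)$ otherwise. For $n\ge 0$ let $\mathcal{W}_2(n)$ be the finite set of vectors $\vec\lambda=(\lambda_1,\lambda_2,\lambda_3,\lambda_4,\lambda_5,2\lambda_6,2\lambda_7)$, where $\lambda_1$ is a partition into distinct even parts, $\lambda_2,\dots,\lambda_5$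 are partitions into odd parts and $\lambda_6,\lambda_7\in\mathcal{P}^*$, such that $$\sigma(\lambda_1)+\cdots+\sigma(\lambda_5)+2\sigma^*(\lambda_6)+2\sigma^*(\lambda_7)=n.$$ The weight and the vector crank of $\vec\lambda$ are $$\widetilde{wt}(\vec\lambda)=(-1)^{\ell(\lambda_1)}wt^*(\lambda_6)\,wt^*(\lambda_7),$$ $$c_7(\vec\lambda)=\ell(\lambda_2)-\ell(\lambda_3)+2\bigl(\ell(\lambda_4)-\ell(\lambda_5)\bigr)+c^*(\lambda_6)+2c^*(\lambda_7).$$ Let $M^*(m,n)$ be the sum of the weights $\widetilde{wt}(\vec\lambda)$ over all $\vec\lambda\in\mathcal{W}_2(n)$ with $c_7(\vec\lambda)=m$, let $M^*_e(n)$ (resp. $M^*_o(n)$) be the sum of the weights over all $\vec\lambda\in\mathcal{W}_2(n)$ with even (resp. odd) vector crank, and let $d(n)=\sum_{m=-\infty}^{\infty}(-1)^mM^*(m,n)$. Then for every integer $n\ge 0$ $$d(n)=M^*_e(n)-M^*_o(n)=\begin{cases}(-1)^m, & \text{if } n=m(3m\pm 1) \text{ for some integer } m,\\ 0, & \text{otherwise.}\end{cases}$$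 -/

import Mathlib

namespace SevenColored

/-- The set of all ordinary partitions: a pair of a natural number and a partition of it
(the empty partition being the only partition of `0`). -/
abbrev Ptn : Type := Σ k : ℕ, k.Partition

namespace Ptn

/-- The sum of all parts of a partition. -/
def size (p : Ptn) : ℕ := p.1

/-- The multiset of parts of a partition. -/
def parts (p : Ptn) : Multiset ℕ := p.2.parts

/-- The number of parts of a partition. -/
def length (p : Ptn) : ℕ := Multiset.card p.parts

/-- The largest part of a partition, `0` for the empty partition. -/
def largest (p : Ptn) : ℕ := p.parts.sup

/-- The number of parts of a partition that are equal to `1`. -/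
def ones (p : Ptn) : ℕ := p.parts.count 1

/-- The Andrews-Garvan crank of a partition: the largest part if there are no ones, and otherwise
the number of parts that are larger than the number of ones, minus the number of ones.
It is `0` for the empty partition. -/
def crank (p : Ptn) : ℤ :=
  if p.ones = 0 then (p.largest : ℤ)
  else (Multiset.card (p.parts.filter fun i => p.ones < i) : ℤ) - (p.ones : ℤ)

/-- All parts are odd. -/
def OddParts (p : Ptn) : Prop := ∀ i ∈ p.parts, Odd i

/-- The parts are distinct and even. -/
def DistinctEvenParts (p : Ptn) : Prop := p.parts.Nodup ∧ ∀ i ∈ p.parts, Even i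

end Ptn

/-- The ordinary partitions together with two additional copies `1*` and `1**` of the
partition `1`. -/
inductive ExtPtn : Type
  | ordinary (p : Ptn) : ExtPtn
  | star : ExtPtn
  | starStar : ExtPtn

namespace ExtPtn

/-- The sum of the parts; both additional copies of the partition `1` have sum `1`. -/
def size : ExtPtn → ℕ
  | ordinary p => p.size
  | star => 1
  | starStar => 1

/-- The weight: `-1` for the ordinary partition `1` (the only one with sum of parts `1`),
and `1` in all other cases. -/
def weight : ExtPtn → ℤ
  | ordinary p => if p.size = 1 then -1 else 1
  | star => 1
  | starStar => 1

/-- The modified crank: `0`, `1`, `-1` for the three copies `1`, `1*`, `1**` of the partition `1`,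
and the Andrews-Garvan crank for all other partitions. -/
def crank : ExtPtn → ℤ
  | ordinary p => if p.size = 1 then 0 else p.crank
  | star => 1
  | starStar => -1

end ExtPtn

/-- A vector of five ordinary partitions and two extended ones. The last two stand for `2 p₆` and
`2 p₇`, that is, they are counted twice in the sum of parts. -/
structure VecPtn : Type where
  p₁ : Ptn
  p₂ : Ptn
  p₃ : Ptn
  p₄ : Ptn
  p₅ : Ptn
  p₆ : ExtPtn
  p₇ : ExtPtn

namespace VecPtn

/-- Membership in the set of weighted 7-colored partitions: the first component has distinct even
parts, the next four have odd parts, and the last two are arbitrary. -/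
def IsColored (v : VecPtn) : Prop :=
  v.p₁.DistinctEvenParts ∧ v.p₂.OddParts ∧ v.p₃.OddParts ∧ v.p₄.OddParts ∧ v.p₅.OddParts

/-- The sum of parts. -/
def size (v : VecPtn) : ℕ :=
  v.p₁.size + v.p₂.size + v.p₃.size + v.p₄.size + v.p₅.size + 2 * v.p₆.size + 2 * v.p₇.size

/-- The weight. -/
def weight (v : VecPtn) : ℤ :=
  (-1) ^ v.p₁.length * v.p₆.weight * v.p₇.weight

/-- The vector crank. -/
def crank (v : VecPtn) : ℤ :=
  (v.p₂.length : ℤ) - (v.p₃.length : ℤ) + 2 * ((v.p₄.length : ℤ) - (v.p₅.length : ℤ))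
    + v.p₆.crank + 2 * v.p₇.crank

end VecPtn

theorem finite_ptn (n : ℕ) : {p : Ptn | p.size ≤ n}.Finite := by
  have h : (Set.range fun x : (Σ k : Fin (n + 1), (k : ℕ).Partition) =>
      (⟨x.1, x.2⟩ : Ptn)).Finite := Set.finite_range _
  refine h.subset ?_
  rintro ⟨k, q⟩ hk
  exact ⟨⟨⟨k, Nat.lt_succ_of_le hk⟩, q⟩, rfl⟩

theorem finite_extPtn (n : ℕ) : {p : ExtPtn | p.size ≤ n}.Finite := by
  refine (((finite_ptn n).image ExtPtn.ordinary).union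
    (Set.toFinite {ExtPtn.star, ExtPtn.starStar})).subset ?_
  rintro (p | _ | _) hp
  · exact Or.inl ⟨p, hp, rfl⟩
  · exact Or.inr (by simp)
  · exact Or.inr (by simp)

theorem finite_colored (n : ℕ) : {v : VecPtn | v.IsColored ∧ v.size = n}.Finite := by
  have h := (finite_ptn n).prod ((finite_ptn n).prod ((finite_ptn n).prod ((finite_ptn n).prod
    ((finite_ptn n).prod ((finite_extPtn n).prod (finite_extPtn n))))))
  refine (h.image fun x =>
    VecPtn.mk x.1 x.2.1 x.2.2.1 x.2.2.2.1 x.2.2.2.2.1 x.2.2.2.2.2.1 x.2.2.2.2.2.2).subset ?_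
  rintro ⟨a, b, c, d, e, f, g⟩ ⟨-, hs⟩
  simp only [VecPtn.size] at hs
  refine ⟨(a, b, c, d, e, f, g), ?_, rfl⟩
  simp only [Set.mem_prod, Set.mem_setOf_eq]
  omega

/-- The finite set of weighted 7-colored partitions of `n`. -/
noncomputable def colored (n : ℕ) : Finset VecPtn := (finite_colored n).toFinset

/-- The (weighted) number of weighted 7-colored partitions of `n` with vector crank `m`. -/
noncomputable def crankCount (m : ℤ) (n : ℕ) : ℤ :=
  ∑ v ∈ (colored n).filter (fun v => v.crank = m), v.weight

/-- The (weighted) number of weighted 7-colored partitions of `n` with even vector crank. -/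
noncomputable def evenCount (n : ℕ) : ℤ :=
  ∑ v ∈ (colored n).filter (fun v => Even v.crank), v.weight

/-- The (weighted) number of weighted 7-colored partitions of `n` with odd vector crank. -/
noncomputable def oddCount (n : ℕ) : ℤ :=
  ∑ v ∈ (colored n).filter (fun v => Odd v.crank), v.weight

/-- For each `n` only finitely many vector cranks occur. -/
theorem finite_support_crankCount (n : ℕ) : {m : ℤ | crankCount m n ≠ 0}.Finite := by
  refine ((colored n).image VecPtn.crank).finite_toSet.subset ?_
  intro m hm
  obtain ⟨v, hv, -⟩ := Finset.exists_ne_zero_of_sum_ne_zero hm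
  rw [Finset.mem_filter] at hv
  exact Finset.mem_coe.2 (Finset.mem_image.2 ⟨v, hv.1, hv.2⟩)

/-- The number of weighted 7-colored partitions of `n`, weighted by the parity of the vector crank:
the sum over all integers `m` of `(-1) ^ m` times the count for vector crank `m`. -/
noncomputable def paritySum (n : ℕ) : ℤ :=
  ∑ᶠ m : ℤ, (-1) ^ m.natAbs * crankCount m n

end SevenColored

open PowerSeries Filter Topology
open scoped PowerSeries.WithPiTopology

namespace SevenColored

/-! Write E = ∏(1 - q^i), P = ∏(1 + q^i). Modulo 2 the vector crank only sees `p₂`, `p₃` and `p₆`,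
so the generating function of d(n) is a product of seven series: E(q²) for `p₁`, A² B² for the odd
parts with A = ∏ 1/(1 + q^(2i-1)) and B = ∏ 1/(1 - q^(2i-1)), S(q²) for `p₆` and W(q²) for `p₇`.
Here W = 1/E is the plain partition series and S is the crank series at -1. Euler's theorem gives A
B = P(q²) (`geomSeries_odd_mul`). The main point is P² S = E (`plusSeries_sq_mul_sizeSeries_crank`).
Then the product collapses to E(q²), and the pentagonal number theorem reads off its coefficients.
For P² S = E, partitions are split by whether they contain ones. Those without ones are sorted by
largest part, the others by the number of ones. Both give series ∑ c_n (-q)^n whose coefficients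
satisfy a q-binomial recursion, hence product formulas. The corrections at small n account for the
terms 2q and 1 - q, which cancel against the extra copies of the partition 1 and against each other.
-/

/-! ### Weighted Euler products. -/

/-- The generating function of partitions into distinct parts, where a part `i` has weight `a i`. -/
noncomputable def distinctSeries (a : ℕ → ℤ) : ℤ⟦X⟧ :=
  Nat.Partition.genFun fun i c => if c = 1 then a i else 0

/-- The generating function of all partitions, where a part `i` has weight `b i`. -/
noncomputable def geomSeries (b : ℕ → ℤ) : ℤ⟦X⟧ :=
  Nat.Partition.genFun fun i c => b i ^ c

theorem hasProd_genFun_C (f : ℕ → ℕ → ℤ) :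
    HasProd (fun i => (1 : ℤ⟦X⟧) + ∑' j, C (f (i + 1) (j + 1)) * X ^ ((i + 1) * (j + 1)))
      (Nat.Partition.genFun f) := by
  have h := Nat.Partition.hasProd_genFun f
  simp only [PowerSeries.smul_eq_C_mul] at h
  exact h

theorem hasProd_distinctSeries (a : ℕ → ℤ) :
    HasProd (fun i => (1 : ℤ⟦X⟧) + C (a (i + 1)) * X ^ (i + 1)) (distinctSeries a) := by
  convert hasProd_genFun_C (fun i c => if c = 1 then a i else 0) using 3 with i
  · rw [tsum_eq_single 0 (by intro j hj; simp [hj])]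
    simp
  · rfl

theorem one_sub_mul_one_add_tsum (b : ℤ) (i : ℕ) :
    (1 + C (-b) * X ^ (i + 1)) * (1 + ∑' j, C (b ^ (j + 1)) * (X : ℤ⟦X⟧) ^ ((i + 1) * (j + 1))) = 1 := by
  have h0 : constantCoeff (C b * (X : ℤ⟦X⟧) ^ (i + 1)) = 0 := by simp
  have h := WithPiTopology.one_sub_mul_tsum_pow_of_constantCoeff_eq_zero h0
  rw [(WithPiTopology.summable_pow_of_constantCoeff_eq_zero h0).tsum_eq_zero_add] at h
  convert h using 2
  · simp [sub_eq_add_neg]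
  · simp only [pow_zero]
    congr 2
    ext1 j
    simp [mul_pow, ← pow_mul]

theorem hasProd_eq_mul {f g h : ℕ → ℤ⟦X⟧} {F G H : ℤ⟦X⟧} (hf : HasProd f F) (hg : HasProd g G)
    (hh : HasProd h H) (e : ∀ i, f i * g i = h i) : F * G = H := by
  have := hf.mul hg
  rw [funext e] at this
  exact this.unique hh

theorem distinctSeries_mul_geomSeries (b : ℕ → ℤ) :
    distinctSeries (fun i => - b i) * geomSeries b = 1 :=
  hasProd_eq_mul (hasProd_distinctSeries _)
    (hasProd_genFun_C (fun i c => b i ^ c)) hasProd_one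
    fun i => one_sub_mul_one_add_tsum (b (i + 1)) i

theorem geomSeries_unique {b : ℕ → ℤ} {F : ℤ⟦X⟧}
    (h : distinctSeries (fun i => - b i) * F = 1) : F = geomSeries b := by
  have h' := distinctSeries_mul_geomSeries b
  calc F = F * (distinctSeries (fun i => - b i) * geomSeries b) := by rw [h', mul_one]
    _ = (distinctSeries (fun i => - b i) * F) * geomSeries b := by ring
    _ = geomSeries b := by rw [h, one_mul]

theorem hasProd_ite_single (k : ℕ) (F : ℤ⟦X⟧) :
    HasProd (fun i => if i + 1 = k + 1 then F else 1) F := by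
  simpa using hasProd_ite_eq k F

/-- Changing the weight of the single part `k + 1` from `0` to `u`. -/
theorem distinctSeries_single (a a' : ℕ → ℤ) (k : ℕ) (u : ℤ) (h0 : a (k + 1) = 0)
    (h1 : a' (k + 1) = u) (h : ∀ i, i ≠ k → a' (i + 1) = a (i + 1)) :
    distinctSeries a * (1 + C u * X ^ (k + 1)) = distinctSeries a' := by
  refine hasProd_eq_mul (hasProd_distinctSeries a) (hasProd_ite_single k _)
    (hasProd_distinctSeries a') fun i => ?_
  by_cases hi : i = k
  · simp only [hi, h0, h1]; simp
  · simp only [h _ hi]; simp [hi]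

/-- Changing the weight of the single part `k + 1` from `u` to `v`. -/
theorem geomSeries_change (b b' : ℕ → ℤ) (k : ℕ) (h : ∀ i, i ≠ k → b' (i + 1) = b (i + 1)) :
    geomSeries b' * (1 - C (b' (k + 1)) * X ^ (k + 1)) =
      geomSeries b * (1 - C (b (k + 1)) * X ^ (k + 1)) := by
  -- With the factor of the part `k + 1` removed, `b` and `b'` give the same product; both sides of
  -- the goal are its inverse.
  set a : ℕ → ℤ := fun i => if i = k + 1 then 0 else - b i with ha
  have e1 := distinctSeries_single a (fun i => - b i) k _ (by simp [ha]) rfl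
    (fun i hi => by simp [ha, hi])
  have e2 := distinctSeries_single a (fun i => - b' i) k _ (by simp [ha]) rfl
    (fun i hi => by simp [ha, hi, h i hi])
  have h1 := distinctSeries_mul_geomSeries b
  have h2 := distinctSeries_mul_geomSeries b'
  rw [← e1] at h1
  rw [← e2] at h2
  simp only [map_neg, neg_mul, ← sub_eq_add_neg] at h1 h2
  linear_combination (geomSeries b * (1 - C (b (k + 1)) * X ^ (k + 1))) * h2
    - (geomSeries b' * (1 - C (b' (k + 1)) * X ^ (k + 1))) * h1

/-- The Euler function `∏ (1 - X ^ i)`. -/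
noncomputable abbrev eulerSeries : ℤ⟦X⟧ := distinctSeries fun _ => -1

/-- The product `∏ (1 + X ^ i)`. -/
noncomputable abbrev plusSeries : ℤ⟦X⟧ := distinctSeries fun _ => 1

theorem eulerSeries_eq_pentagonalSeries : eulerSeries = pentagonalSeries ℤ := by
  refine (hasProd_distinctSeries _).unique ?_
  convert WithPiTopology.hasProd_one_sub_X_pow ℤ using 2
  simp [sub_eq_add_neg]

theorem continuous_expand_two :
    Continuous (fun F : ℤ⟦X⟧ => expand 2 two_ne_zero F) := by
  rw [continuous_iff_continuousAt]
  intro F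
  rw [ContinuousAt, WithPiTopology.tendsto_iff_coeff_tendsto]
  intro d
  simp only [coeff_expand]
  split_ifs
  · exact (WithPiTopology.continuous_coeff ℤ _).tendsto F
  · exact tendsto_const_nhds

theorem hasProd_expand {f : ℕ → ℤ⟦X⟧} {F : ℤ⟦X⟧} (h : HasProd f F) :
    HasProd (fun i => expand 2 two_ne_zero (f i)) (expand 2 two_ne_zero F) :=
  h.map (expand (R := ℤ) 2 two_ne_zero) continuous_expand_two

/-- Doubling every part gives partitions into even parts. -/
theorem expand_distinctSeries (a a' : ℕ → ℤ) (h0 : ∀ i, a' (2 * i + 1) = 0)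
    (h1 : ∀ i, a' (2 * i) = a i) :
    expand 2 two_ne_zero (distinctSeries a) = distinctSeries a' := by
  refine (hasProd_expand (hasProd_distinctSeries a)).unique ?_
  -- Factor `i` carries the part `i + 1`, so the even part `2 * (i + 1)` sits at index `2 * i + 1`;
  -- all other factors are `1`.
  have hinj : Function.Injective fun i : ℕ => 2 * i + 1 := fun i j h => by simpa using h
  have := (hinj.hasProd_iff (a := distinctSeries a')
    (f := fun i => (1 : ℤ⟦X⟧) + C (a' (i + 1)) * X ^ (i + 1)) ?_).2 (hasProd_distinctSeries a')
  · convert this using 2 with i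
    simp [← h1, ← pow_mul, mul_add]
  · intro i hi
    obtain ⟨j, rfl | rfl⟩ := Nat.even_or_odd' i
    · simp [h0]
    · exact absurd ⟨_, rfl⟩ hi

theorem plusSeries_mul_eulerSeries :
    plusSeries * eulerSeries = expand 2 two_ne_zero eulerSeries := by
  refine hasProd_eq_mul (hasProd_distinctSeries _) (hasProd_distinctSeries _)
    (hasProd_expand (hasProd_distinctSeries _)) fun i => ?_
  simp only [map_one, map_neg, one_mul, neg_mul, map_add, map_pow, expand_X]
  ring

theorem eulerSeries_ne_zero : eulerSeries ≠ 0 := by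
  intro h
  have := distinctSeries_mul_geomSeries fun _ => 1
  simp [eulerSeries] at h
  simp [h] at this

/-- Euler: the product over the odd parts, multiplied by `∏ (1 + X ^ i)`, is `1`. -/
theorem distinctSeries_odd_mul_plusSeries :
    distinctSeries (fun i => if Odd i then -1 else 0) * plusSeries = 1 := by
  -- Odd factors times even factors give E, while the even ones are E(q²) = P E; then E cancels.
  have h : distinctSeries (fun i => if Odd i then -1 else 0) * expand 2 two_ne_zero eulerSeries
      = eulerSeries := by
    rw [expand_distinctSeries _ (fun i => if Even i then -1 else 0) (by simp) (by simp)]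
    refine hasProd_eq_mul (hasProd_distinctSeries _) (hasProd_distinctSeries _)
      (hasProd_distinctSeries _) fun i => ?_
    by_cases hi : Odd (i + 1)
    · simp [hi, Nat.not_even_iff_odd.2 hi]
    · simp [hi, Nat.not_odd_iff_even.1 hi]
  rw [← plusSeries_mul_eulerSeries] at h
  exact mul_right_cancel₀ eulerSeries_ne_zero (by linear_combination h)

/-- The product of the generating functions of partitions into odd parts with and without sign. -/
theorem geomSeries_odd_mul :
    geomSeries (fun i => if Odd i then -1 else 0) * geomSeries (fun i => if Odd i then 1 else 0)
      = expand 2 two_ne_zero plusSeries := by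
  have h1 := distinctSeries_mul_geomSeries fun i => if Odd i then -1 else 0
  have h2 := distinctSeries_mul_geomSeries fun i => if Odd i then 1 else 0
  -- Factorwise (1 + q^i)(1 - q^i) = 1 - q^(2i) for odd i; Euler's identity in q² then supplies the
  -- inverse.
  have h3 : distinctSeries (fun i => - if Odd i then -1 else 0) *
      distinctSeries (fun i => - if Odd i then 1 else 0) =
      expand 2 two_ne_zero (distinctSeries (fun i => if Odd i then -1 else 0)) := by
    refine hasProd_eq_mul (hasProd_distinctSeries _) (hasProd_distinctSeries _)
      (hasProd_expand (hasProd_distinctSeries _)) fun i => ?_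
    split_ifs
    · simp only [map_one, map_neg, one_mul, neg_mul, map_add, map_pow, expand_X, neg_neg]
      ring
    · simp
  have h4 := congrArg (expand 2 two_ne_zero) distinctSeries_odd_mul_plusSeries
  rw [map_mul, map_one, ← h3] at h4
  calc _ = geomSeries (fun i => if Odd i then -1 else 0) *
        geomSeries (fun i => if Odd i then 1 else 0) * 1 := by rw [mul_one]
    _ = (distinctSeries (fun i => - if Odd i then -1 else 0) *
        geomSeries (fun i => if Odd i then -1 else 0)) *
        (distinctSeries (fun i => - if Odd i then 1 else 0) *
        geomSeries (fun i => if Odd i then 1 else 0)) * expand 2 two_ne_zero plusSeries := by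
      rw [← h4]; ring
    _ = expand 2 two_ne_zero plusSeries := by rw [h1, h2, one_mul, one_mul]

/-! ### The q-binomial theorem. -/

theorem summable_mul_pow (c : ℕ → ℤ⟦X⟧) (t : ℤ⟦X⟧) (ht : constantCoeff t = 0) :
    Summable fun n => c n * t ^ n := by
  refine WithPiTopology.summable_of_tendsto_order_atTop_nhds_top ℤ ?_
  refine ENat.tendsto_nhds_top_iff_natCast_lt.mpr fun n => eventually_atTop.mpr ⟨n + 1, ?_⟩
  intro m hm
  have h1 : (X : ℤ⟦X⟧) ^ m ∣ c m * t ^ m :=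
    Dvd.dvd.mul_left (pow_dvd_pow_of_dvd (X_dvd_iff.2 ht) m) _
  have h2 := X_pow_dvd_iff.1 h1
  have h3 : (m : ℕ∞) ≤ (c m * t ^ m).order := le_order _ _ fun i hi => h2 i (by exact_mod_cast hi)
  exact lt_of_lt_of_le (by exact_mod_cast hm) h3

/-- One step of the `q`-binomial theorem. -/
theorem qbinomial_step (c : ℕ → ℤ⟦X⟧) (a t : ℤ⟦X⟧) (ht : constantCoeff t = 0)
    (hc : ∀ n, (1 - X ^ (n + 1)) * c (n + 1) = (1 - a * X ^ n) * c n) :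
    (1 - t) * ∑' n, c n * t ^ n = (1 - a * t) * ∑' n, c n * (X * t) ^ n := by
  have hs1 := summable_mul_pow c t ht
  have hs2 := summable_mul_pow c (X * t) (by simp)
  -- With F(t) = ∑ c_n t^n, the recursion turns F(t) - F(qt) = ∑ c_n (1 - q^n) t^n into t (F(t) - a
  -- F(qt)).
  have e1 : ∑' n, c n * t ^ n - ∑' n, c n * (X * t) ^ n =
      ∑' n, c (n + 1) * (1 - X ^ (n + 1)) * t ^ (n + 1) := by
    rw [← hs1.tsum_sub hs2, (hs1.sub hs2).tsum_eq_zero_add]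
    simp only [pow_zero, sub_self, zero_add]
    refine tsum_congr fun n => ?_
    rw [mul_pow]; ring
  have e2 : t * (∑' n, c n * t ^ n - a * ∑' n, c n * (X * t) ^ n) =
      ∑' n, c (n + 1) * (1 - X ^ (n + 1)) * t ^ (n + 1) := by
    rw [← hs2.tsum_mul_left, ← hs1.tsum_sub (hs2.mul_left a),
      ← (hs1.sub (hs2.mul_left a)).tsum_mul_left]
    refine tsum_congr fun n => ?_
    rw [mul_pow, mul_comm (c (n + 1)), hc]; ring
  linear_combination e1 - e2

/-- Iterates `qbinomial_step` along t = -q, -q², …, -q^N. -/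
theorem qbinomial_prod (c : ℕ → ℤ⟦X⟧) (a : ℤ⟦X⟧)
    (hc : ∀ n, (1 - X ^ (n + 1)) * c (n + 1) = (1 - a * X ^ n) * c n) (N : ℕ) :
    (∏ j ∈ Finset.range N, (1 + X ^ (j + 1))) * ∑' n, c n * (-X) ^ n =
      (∏ j ∈ Finset.range N, (1 + a * X ^ (j + 1))) * ∑' n, c n * (-X ^ (N + 1)) ^ n := by
  induction N with
  | zero => simp
  | succ N ih =>
    have h := qbinomial_step c a (-X ^ (N + 1)) (by simp) hc
    rw [show (X : ℤ⟦X⟧) * -X ^ (N + 1) = -X ^ (N + 1 + 1) by ring] at h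
    rw [Finset.prod_range_succ, Finset.prod_range_succ]
    linear_combination (1 + X ^ (N + 1)) * ih +
      (∏ j ∈ Finset.range N, (1 + a * X ^ (j + 1))) * h

/-- Every term except n = 0 is divisible by q^(N+1), so each coefficient is eventually constant in
N. -/
theorem tendsto_tsum_mul_pow (c : ℕ → ℤ⟦X⟧) :
    Tendsto (fun N => ∑' n, c n * (-X ^ (N + 1)) ^ n) atTop (𝓝 (c 0)) := by
  rw [WithPiTopology.tendsto_iff_coeff_tendsto]
  refine fun d => tendsto_atTop_of_eventually_const (i₀ := d) fun N hN => ?_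
  have hs := summable_mul_pow c (-X ^ (N + 1)) (by simp)
  rw [hs.tsum_eq_zero_add]
  have h1 : (X : ℤ⟦X⟧) ^ (N + 1) ∣ ∑' n, c (n + 1) * (-X ^ (N + 1)) ^ (n + 1) := by
    refine ⟨∑' n, - c (n + 1) * (-X ^ (N + 1)) ^ n, ?_⟩
    rw [← (summable_mul_pow (fun n => - c (n + 1)) (-X ^ (N + 1)) (by simp)).tsum_mul_left]
    exact tsum_congr fun n => by ring
  simp [X_pow_dvd_iff.1 h1 d (by omega)]

/-- The `q`-binomial theorem at `t = -X`. -/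
theorem qbinomial (c : ℕ → ℤ⟦X⟧) (a u F : ℤ⟦X⟧)
    (hc : ∀ n, (1 - X ^ (n + 1)) * c (n + 1) = (1 - a * X ^ n) * c n)
    (hF : Tendsto (fun N => u * ∏ j ∈ Finset.range N, (1 + a * X ^ (j + 1))) atTop (𝓝 F)) :
    u * (plusSeries * ∑' n, c n * (-X) ^ n) = F * c 0 := by
  have h1 := (((hasProd_distinctSeries fun _ => 1).tendsto_prod_nat).mul_const
    (∑' n, c n * (-X) ^ n)).const_mul u
  have h2 := hF.mul (tendsto_tsum_mul_pow c)
  refine tendsto_nhds_unique h1 (h2.congr fun N => ?_)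
  simp only [map_one, one_mul]
  rw [qbinomial_prod c a hc N, mul_assoc]

/-- Euler's expansion of `∏ (1 + X ^ i)⁻¹`. -/
theorem plusSeries_mul_tsum_of_euler (c : ℕ → ℤ⟦X⟧)
    (hc : ∀ n, (1 - X ^ (n + 1)) * c (n + 1) = c n) :
    plusSeries * ∑' n, c n * (-X) ^ n = c 0 := by
  simpa using qbinomial c 0 1 1 (by simpa using hc) (by simp)

/-- The q-binomial theorem with a = -q: its product starts at 1 - q², and u = 1 - q restores the
missing factor of E. -/
theorem plusSeries_mul_tsum_of_eulerSeries (c : ℕ → ℤ⟦X⟧) (h0 : c 0 = 1 - X)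
    (hc : ∀ n, (1 - X ^ (n + 1)) * c (n + 1) = (1 + X ^ (n + 1)) * c n) :
    plusSeries * ∑' n, c n * (-X) ^ n = eulerSeries := by
  have hX : (1 : ℤ⟦X⟧) - X ≠ 0 := fun h => by simpa using congrArg constantCoeff h
  refine mul_left_cancel₀ hX ?_
  rw [qbinomial c (-X) (1 - X) eulerSeries, h0, mul_comm]
  · intro n
    rw [hc]; ring
  · have h := (tendsto_add_atTop_iff_nat 1).2
      (hasProd_distinctSeries fun _ => -1).tendsto_prod_nat
    refine h.congr fun N => ?_
    rw [Finset.prod_range_succ', mul_comm]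
    congr 1
    · simp [sub_eq_add_neg]
    · refine Finset.prod_congr rfl fun j _ => ?_
      simp only [map_neg, map_one]
      ring

/-! ### Weighted sums over partitions. -/

/-- The generating function of all partitions with weight `w`. -/
noncomputable def ptnSeries (w : Ptn → ℤ) : ℤ⟦X⟧ :=
  PowerSeries.mk fun n => ∑ q : n.Partition, w ⟨n, q⟩

theorem ptnSeries_add (w w' : Ptn → ℤ) :
    ptnSeries (fun p => w p + w' p) = ptnSeries w + ptnSeries w' := by
  ext n; simp [ptnSeries, Finset.sum_add_distrib]

theorem ptnSeries_sub (w w' : Ptn → ℤ) :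
    ptnSeries (fun p => w p - w' p) = ptnSeries w - ptnSeries w' := by
  ext n; simp [ptnSeries, Finset.sum_sub_distrib]

theorem ptnSeries_const_mul (a : ℤ) (w : Ptn → ℤ) :
    ptnSeries (fun p => a * w p) = C a * ptnSeries w := by
  ext n; simp only [ptnSeries, coeff_C_mul, coeff_mk, Finset.mul_sum]

theorem toFinsupp_prod (f : ℕ → ℕ → ℤ) (m : Multiset ℕ) :
    m.toFinsupp.prod f = ∏ i ∈ m.toFinset, f i (m.count i) := by
  simp [Finsupp.prod]

theorem geomSeries_eq_ptnSeries (b : ℕ → ℤ) :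
    geomSeries b = ptnSeries fun p => (p.parts.map b).prod := by
  ext n
  simp only [geomSeries, Nat.Partition.coeff_genFun, ptnSeries, coeff_mk]
  refine Finset.sum_congr rfl fun q _ => ?_
  rw [Finset.prod_multiset_map_count]
  simp [Finsupp.prod, Ptn.parts]

theorem distinctSeries_eq_ptnSeries (a : ℕ → ℤ) :
    distinctSeries a = ptnSeries fun p => if p.parts.Nodup then (p.parts.map a).prod else 0 := by
  ext n
  simp only [distinctSeries, Nat.Partition.coeff_genFun, ptnSeries, coeff_mk]
  refine Finset.sum_congr rfl fun q _ => ?_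
  rw [toFinsupp_prod]
  change _ = if q.parts.Nodup then (q.parts.map a).prod else 0
  by_cases h : q.parts.Nodup
  · rw [if_pos h, Finset.prod_multiset_map_count]
    refine Finset.prod_congr rfl fun i hi => ?_
    rw [Multiset.count_eq_one_of_mem h (Multiset.mem_toFinset.1 hi), if_pos rfl, pow_one]
  · rw [if_neg h]
    rw [Multiset.nodup_iff_count_le_one] at h
    push Not at h
    obtain ⟨i, hi⟩ := h
    have hm : i ∈ q.parts.toFinset := Multiset.mem_toFinset.2 (Multiset.count_pos.1 (by omega))
    exact Finset.prod_eq_zero hm (if_neg (by omega))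

theorem prod_map_zero_one (P : ℕ → Prop) [DecidablePred P] (m : Multiset ℕ)
    [Decidable (∀ i ∈ m, P i)] :
    (m.map fun i => if P i then (1 : ℤ) else 0).prod = if ∀ i ∈ m, P i then 1 else 0 := by
  split_ifs with h
  · refine Multiset.prod_eq_one fun x hx => ?_
    obtain ⟨i, hi, rfl⟩ := Multiset.mem_map.1 hx
    simp [h i hi]
  · push Not at h
    obtain ⟨i, hi, hP⟩ := h
    exact Multiset.prod_eq_zero (Multiset.mem_map.2 ⟨i, hi, by simp [hP]⟩)

theorem prod_map_sign (P : ℕ → Prop) [DecidablePred P] (m : Multiset ℕ) :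
    (m.map fun i => if P i then (-1 : ℤ) else 1).prod = (-1) ^ Multiset.card (m.filter P) := by
  induction m using Multiset.induction with
  | empty => simp
  | cons a m ih =>
    by_cases h : P a
    · simp [h, ih, pow_succ]
    · simp [h, ih]

/-- Sorting partitions by a statistic bounded by the size. -/
theorem hasSum_ptnSeries (t : Ptn → ℕ) (ht : ∀ p, t p ≤ p.size) (w : Ptn → ℤ) :
    HasSum (fun k => ptnSeries fun p => if t p = k then w p else 0) (ptnSeries w) := by
  rw [WithPiTopology.hasSum_iff_hasSum_coeff]
  intro n
  have h : coeff n (ptnSeries w) = ∑ k ∈ Finset.range (n + 1),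
      coeff n (ptnSeries fun p => if t p = k then w p else 0) := by
    simp only [ptnSeries, coeff_mk]
    rw [Finset.sum_comm]
    refine Finset.sum_congr rfl fun q _ => ?_
    rw [Finset.sum_ite_eq, if_pos]
    have := ht ⟨n, q⟩
    exact Finset.mem_range.2 (Nat.lt_succ_of_le this)
  rw [h]
  refine hasSum_sum_of_ne_finset_zero fun k hk => ?_
  simp only [ptnSeries, coeff_mk]
  refine Finset.sum_eq_zero fun q _ => if_neg fun e => hk ?_
  have := ht ⟨n, q⟩
  exact Finset.mem_range.2 (Nat.lt_succ_of_le (e ▸ this))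

theorem Ptn.le_size_of_mem (p : Ptn) {i : ℕ} (hi : i ∈ p.parts) : i ≤ p.size := by
  obtain ⟨n, q⟩ := p
  exact (Multiset.le_sum_of_mem hi).trans_eq q.parts_sum

theorem Ptn.largest_le_size (p : Ptn) : p.largest ≤ p.size :=
  Multiset.sup_le.2 fun _ hi => p.le_size_of_mem hi

theorem Ptn.length_le_size (p : Ptn) : p.length ≤ p.size := by
  obtain ⟨n, q⟩ := p
  have := Multiset.card_nsmul_le_sum (s := q.parts) (a := 1) fun i hi => q.parts_pos hi
  rw [q.parts_sum] at this
  simpa [Ptn.length, Ptn.parts, Ptn.size] using this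

theorem Ptn.ones_le_size (p : Ptn) : p.ones ≤ p.size :=
  (Multiset.count_le_card _ _).trans p.length_le_size

theorem Ptn.ones_eq_zero_iff (p : Ptn) : p.ones = 0 ↔ ∀ i ∈ p.parts, 2 ≤ i := by
  rw [Ptn.ones, Multiset.count_eq_zero]
  constructor
  · intro h i hi
    have h0 : 0 < i := p.2.parts_pos hi
    have h1 : i ≠ 1 := fun e => h (e ▸ hi)
    omega
  · intro h h1
    have := h 1 h1
    omega

/-! ### Partitions without ones, sorted by largest part. -/

/-- The generating function of partitions with parts in `{2, …, k}`. -/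
noncomputable def noOnesSeries (k : ℕ) : ℤ⟦X⟧ :=
  geomSeries fun i => if 2 ≤ i ∧ i ≤ k then 1 else 0

theorem noOnesSeries_succ {k : ℕ} (hk : 1 ≤ k) :
    (1 - X ^ (k + 1)) * noOnesSeries (k + 1) = noOnesSeries k := by
  have h := geomSeries_change (fun i => if 2 ≤ i ∧ i ≤ k then 1 else 0)
    (fun i => if 2 ≤ i ∧ i ≤ k + 1 then 1 else 0) k (fun i hi => by
      congr 1
      exact propext (by omega))
  rw [if_pos ⟨by omega, le_rfl⟩, if_neg (by omega)] at h
  simpa [mul_comm, noOnesSeries] using h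

theorem noOnesSeries_eq_one {k : ℕ} (hk : k ≤ 1) : noOnesSeries k = 1 := by
  refine (geomSeries_unique ?_).symm
  rw [mul_one]
  refine (hasProd_distinctSeries _).unique ?_
  convert (hasProd_one : HasProd (fun _ : ℕ => (1 : ℤ⟦X⟧)) 1) using 2 with i
  rw [if_neg (by omega)]
  simp

theorem noOnesSeries_eq_ptnSeries (k : ℕ) :
    noOnesSeries k = ptnSeries fun p => if p.ones = 0 ∧ p.largest ≤ k then 1 else 0 := by
  classical
  rw [noOnesSeries, geomSeries_eq_ptnSeries]
  congr 1
  ext p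
  rw [prod_map_zero_one]
  congr 1
  rw [p.ones_eq_zero_iff, Ptn.largest, Multiset.sup_le, forall₂_and]

/-- Partitions without ones and with largest part `k`. -/
theorem ptnSeries_largest (k : ℕ) :
    ptnSeries (fun p => if p.largest = k then (if p.ones = 0 then 1 else 0) else 0) =
      if k = 0 then 1 else if k = 1 then 0 else X ^ k * noOnesSeries k := by
  rcases k with _ | k
  · simp only [if_true]
    rw [← noOnesSeries_eq_one zero_le_one, noOnesSeries_eq_ptnSeries]
    congr 1
    ext p
    simp only [Nat.le_zero, ← ite_and, and_comm]
  · have h : ptnSeries (fun p => if p.largest = k + 1 then (if p.ones = 0 then 1 else 0) else 0) =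
        noOnesSeries (k + 1) - noOnesSeries k := by
      rw [noOnesSeries_eq_ptnSeries, noOnesSeries_eq_ptnSeries, ← ptnSeries_sub]
      congr 1
      ext p
      grind
    rw [h, if_neg (by omega)]
    split_ifs with h1
    · rw [noOnesSeries_eq_one (by omega), noOnesSeries_eq_one (by omega), sub_self]
    · rw [← noOnesSeries_succ (by omega : 1 ≤ k)]
      ring

/-- Partitions without ones, weighted by the parity of the largest part. -/
theorem plusSeries_mul_ptnSeries_largest :
    plusSeries * (ptnSeries (fun p => if p.ones = 0 then (-1) ^ p.largest else 0) - 2 * X) =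
      1 - X := by
  -- The value 1 - q at 0 is forced by the recursion, since c 1 = 1. The true terms at k = 0 and k =
  -- 1 are 1 and 0 instead of 1 - q and -q, so each exceeds its counterpart by q; this is the source
  -- of 2q.
  set c : ℕ → ℤ⟦X⟧ := fun n => if n = 0 then 1 - X else noOnesSeries n with hc
  have h := plusSeries_mul_tsum_of_euler c (fun n => by
    rcases n with _ | n
    · simp [hc, noOnesSeries_eq_one le_rfl]
    · simp only [hc, if_neg (Nat.succ_ne_zero _)]
      exact noOnesSeries_succ (by omega))
  have hs := (summable_mul_pow c (-X) (by simp)).hasSum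
  have h0 : HasSum (fun n : ℕ => if n = 0 then (X : ℤ⟦X⟧) else 0) X := hasSum_ite_eq 0 X
  have h1 : HasSum (fun n : ℕ => if n = 1 then (X : ℤ⟦X⟧) else 0) X := hasSum_ite_eq 1 X
  have hl := hasSum_ptnSeries Ptn.largest Ptn.largest_le_size
    fun p => if p.ones = 0 then (-1) ^ p.largest else 0
  have e : ptnSeries (fun p => if p.ones = 0 then (-1) ^ p.largest else 0) =
      ∑' n, c n * (-X) ^ n + X + X := by
    refine hl.unique ?_
    convert (hs.add h0).add h1 using 2 with k
    have : (ptnSeries fun p => if p.largest = k then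
        (if p.ones = 0 then (-1) ^ p.largest else 0) else 0) = C ((-1) ^ k) *
        ptnSeries (fun p => if p.largest = k then (if p.ones = 0 then 1 else 0) else 0) := by
      rw [← ptnSeries_const_mul]
      congr 1
      ext p
      split_ifs with h1 <;> simp [h1]
    rw [this, ptnSeries_largest]
    rcases k with _ | _ | k
    · simp [hc]
    · simp [hc, noOnesSeries_eq_one le_rfl]
    · simp [hc]
      rw [neg_pow X]
      ring
  rw [e]
  simp only [hc, if_true] at h
  linear_combination h

/-! ### Partitions with ones, sorted by the number of ones. -/

/-- The number of parts of a partition that are larger than the number of ones. -/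
def Ptn.overOnes (p : Ptn) : ℕ := Multiset.card (p.parts.filter fun i => p.ones < i)

/-- Partitions without ones, weighted by the parity of the number of parts larger than `n`. -/
noncomputable def signedNoOnesSeries (n : ℕ) : ℤ⟦X⟧ :=
  geomSeries fun i => if i = 1 then 0 else if n < i then -1 else 1

/-- Only the part n + 1 changes sign, which replaces 1/(1 + q^(n+1)) by 1/(1 - q^(n+1)). -/
theorem signedNoOnesSeries_succ {n : ℕ} (hn : 1 ≤ n) :
    (1 - X ^ (n + 1)) * signedNoOnesSeries (n + 1) =
      (1 + X ^ (n + 1)) * signedNoOnesSeries n := by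
  have h := geomSeries_change (fun i => if i = 1 then 0 else if n < i then -1 else 1)
    (fun i => if i = 1 then 0 else if n + 1 < i then -1 else 1) n (fun i hi => by
      split_ifs <;> omega)
  rw [if_neg (by omega), if_neg (by omega), if_neg (by omega), if_pos (by omega)] at h
  simp only [map_one, map_neg, one_mul, neg_mul, sub_neg_eq_add] at h
  rw [mul_comm, signedNoOnesSeries, h, mul_comm, signedNoOnesSeries]

/-- All parts from 2 on have weight -1, so the series is 1/P without its factor 1/(1 + q). -/
theorem plusSeries_mul_signedNoOnesSeries_one :
    plusSeries * signedNoOnesSeries 1 = 1 + X := by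
  have h := geomSeries_change (fun _ => -1)
    (fun i => if i = 1 then 0 else if 1 < i then -1 else 1) 0 (fun i hi => by simp [hi, Nat.pos_of_ne_zero hi])
  have h1 := distinctSeries_mul_geomSeries fun _ => -1
  simp only [zero_add, if_true, map_zero, zero_mul, sub_zero, mul_one, map_neg, map_one, one_mul,
    pow_one, neg_mul, sub_neg_eq_add, neg_neg] at h h1
  rw [signedNoOnesSeries, h, plusSeries, ← mul_assoc, h1, one_mul]

theorem signedNoOnesSeries_eq_ptnSeries (n : ℕ) :
    signedNoOnesSeries n = ptnSeries fun p =>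
      if p.ones = 0 then (-1) ^ Multiset.card (p.parts.filter fun i => n < i) else 0 := by
  rw [signedNoOnesSeries, geomSeries_eq_ptnSeries]
  congr 1
  ext p
  split_ifs with h
  · rw [← prod_map_sign]
    refine congrArg _ (Multiset.map_congr rfl fun i hi => if_neg ?_)
    have := p.ones_eq_zero_iff.1 h i hi
    omega
  · exact Multiset.prod_eq_zero (Multiset.mem_map.2
      ⟨1, Multiset.count_pos.1 (Nat.pos_of_ne_zero h), if_pos rfl⟩)

/-- The weight of parts for partitions with no or exactly `n` ones. -/
def onesWeight (n i c : ℕ) : ℤ :=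
  if i = 1 then (if c = n then 1 else 0) else (if n < i then -1 else 1) ^ c

theorem genFun_onesWeight_eq_mul {n : ℕ} (hn : 1 ≤ n) :
    Nat.Partition.genFun (onesWeight n) = (1 + X ^ n) * signedNoOnesSeries n := by
  symm
  rw [mul_comm]
  refine hasProd_eq_mul (hasProd_genFun_C _) (hasProd_ite_single 0 _)
    (hasProd_genFun_C (onesWeight n)) fun i => ?_
  rcases i with _ | i
  · rw [tsum_eq_single (n - 1) (f := fun j => C (onesWeight n (0 + 1) (j + 1)) *
      (X : ℤ⟦X⟧) ^ ((0 + 1) * (j + 1)))]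
    · simp [onesWeight, Nat.sub_add_cancel hn]
    · intro j hj
      simp [onesWeight, show j + 1 ≠ n by omega]
  · simp [onesWeight]

/-- The product in `genFun` runs only over parts that occur, so an absent part 1 contributes the
factor 1. Partitions without ones are therefore included, and `ptnSeries_ones` has to subtract them.
-/
theorem genFun_onesWeight_eq_ptnSeries {n : ℕ} (hn : 1 ≤ n) :
    Nat.Partition.genFun (onesWeight n) = ptnSeries fun p =>
      if p.ones = 0 ∨ p.ones = n then
        (-1) ^ Multiset.card (p.parts.filter fun i => n < i) else 0 := by
  ext m
  simp only [Nat.Partition.coeff_genFun, ptnSeries, coeff_mk]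
  refine Finset.sum_congr rfl fun q _ => ?_
  rw [toFinsupp_prod]
  change _ = if q.parts.count 1 = 0 ∨ q.parts.count 1 = n then
        (-1) ^ Multiset.card (q.parts.filter fun i => n < i) else 0
  split_ifs with h
  · rw [← prod_map_sign, Finset.prod_multiset_map_count]
    refine Finset.prod_congr rfl fun i hi => ?_
    by_cases h1 : i = 1
    · subst h1
      have h2 := Multiset.count_pos.2 (Multiset.mem_toFinset.1 hi)
      rw [onesWeight, if_pos rfl, if_pos (by omega), if_neg (by omega), one_pow]
    · rw [onesWeight, if_neg h1]
  · have hm : 1 ∈ q.parts.toFinset := Multiset.mem_toFinset.2 (Multiset.count_pos.1 (by omega))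
    refine Finset.prod_eq_zero hm ?_
    rw [onesWeight, if_pos rfl, if_neg (by omega)]

/-- Partitions with exactly `n` ones. -/
theorem ptnSeries_ones {n : ℕ} (hn : 1 ≤ n) :
    ptnSeries (fun p => if p.ones = n then (-1) ^ p.overOnes else 0) =
      X ^ n * signedNoOnesSeries n := by
  have h : ptnSeries (fun p => if p.ones = n then (-1) ^ p.overOnes else 0) =
      Nat.Partition.genFun (onesWeight n) - signedNoOnesSeries n := by
    rw [genFun_onesWeight_eq_ptnSeries hn, signedNoOnesSeries_eq_ptnSeries, ← ptnSeries_sub]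
    congr 1
    ext p
    by_cases h1 : p.ones = n
    · rw [if_pos h1, if_pos (Or.inr h1), if_neg (by omega), sub_zero, Ptn.overOnes, h1]
    · simp [h1]
  rw [h, genFun_onesWeight_eq_mul hn]
  ring

/-- Partitions with ones, weighted by the parity of the crank. -/
theorem plusSeries_mul_plusSeries_mul_ptnSeries_ones :
    plusSeries * (plusSeries *
      ptnSeries (fun p => if p.ones = 0 then 0 else (-1) ^ (p.ones + p.overOnes)) + (1 - X)) =
      eulerSeries := by
  -- The factor P makes c 1 = 1 + q, and c 0 = 1 - q is then what the recursion requires at n = 0.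
  -- No partition with ones belongs to index 0, hence the added 1 - q in the statement.
  set c : ℕ → ℤ⟦X⟧ := fun n => if n = 0 then 1 - X else plusSeries * signedNoOnesSeries n with hc
  have h := plusSeries_mul_tsum_of_eulerSeries c (by simp [hc]) (fun n => by
    rcases n with _ | n
    · simp [hc, plusSeries_mul_signedNoOnesSeries_one]
      ring
    · simp only [hc, if_neg (Nat.succ_ne_zero _)]
      rw [mul_left_comm, signedNoOnesSeries_succ (by omega), mul_left_comm])
  have hs := (summable_mul_pow c (-X) (by simp)).hasSum
  have h0 : HasSum (fun n : ℕ => if n = 0 then (1 - X : ℤ⟦X⟧) else 0) (1 - X) := hasSum_ite_eq 0 _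
  have hl := (hasSum_ptnSeries Ptn.ones Ptn.ones_le_size
    fun p => if p.ones = 0 then 0 else (-1) ^ (p.ones + p.overOnes)).mul_left plusSeries
  rw [← h]
  congr 1
  refine (hl.add h0).unique ((congrArg (HasSum · _) (funext fun k => ?_)).mpr hs)
  rcases k with _ | k
  · have : (ptnSeries fun p => if p.ones = 0 then
        (if p.ones = 0 then 0 else (-1) ^ (p.ones + p.overOnes)) else 0) = 0 := by
      ext n
      simp only [ptnSeries, coeff_mk, map_zero]
      exact Finset.sum_eq_zero fun q _ => by split_ifs <;> rfl
    rw [this]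
    simp [hc]
  · have : (ptnSeries fun p => if p.ones = k + 1 then
        (if p.ones = 0 then 0 else (-1) ^ (p.ones + p.overOnes)) else 0) = C ((-1) ^ (k + 1)) *
        ptnSeries (fun p => if p.ones = k + 1 then (-1) ^ p.overOnes else 0) := by
      rw [← ptnSeries_const_mul]
      congr 1
      ext p
      split_ifs with h1 h2
      · omega
      · rw [h1, pow_add]
      · simp
    rw [this, ptnSeries_ones (by omega)]
    simp only [hc, if_neg (Nat.succ_ne_zero _), map_pow, map_neg, map_one, neg_pow X (k + 1)]
    ring

/-! ### The crank generating function at -1. -/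

theorem neg_one_pow_crank (p : Ptn) :
    (-1 : ℤ) ^ p.crank.natAbs = (if p.ones = 0 then (-1) ^ p.largest else 0) +
      (if p.ones = 0 then 0 else (-1) ^ (p.ones + p.overOnes)) := by
  by_cases h : p.ones = 0
  · simp [Ptn.crank, h]
  · rw [Ptn.crank, if_neg h, if_neg h, if_neg h, zero_add]
    change (-1) ^ ((p.overOnes : ℤ) - p.ones).natAbs = _
    rcases Nat.even_or_odd (p.ones + p.overOnes) with h1 | h1
    · rw [h1.neg_one_pow, Even.neg_one_pow]
      grind
    · rw [h1.neg_one_pow, Odd.neg_one_pow]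
      grind

/-- The crank generating function at `-1`. -/
theorem plusSeries_sq_mul_ptnSeries_crank :
    plusSeries ^ 2 * (ptnSeries (fun p => (-1) ^ p.crank.natAbs) - 2 * X) = eulerSeries := by
  have h1 := plusSeries_mul_plusSeries_mul_ptnSeries_ones
  have h2 := plusSeries_mul_ptnSeries_largest
  rw [funext neg_one_pow_crank, ptnSeries_add]
  linear_combination h1 + plusSeries * h2

/-! ### Generating functions by size, products and extended partitions. -/

/-- The generating function of a type whose elements have a size and a weight. -/
noncomputable def sizeSeries {α : Type*} (s : α → ℕ) (w : α → ℤ) : ℤ⟦X⟧ :=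
  PowerSeries.mk fun n => ∑ᶠ a ∈ s ⁻¹' {n}, w a

/-- There are finitely many elements of any given size. -/
def FiniteSizes {α : Type*} (s : α → ℕ) : Prop := ∀ n, (s ⁻¹' {n}).Finite

theorem FiniteSizes.coeff_sizeSeries {α : Type*} {s : α → ℕ} (hs : FiniteSizes s) (w : α → ℤ)
    (n : ℕ) : coeff n (sizeSeries s w) = ∑ a ∈ (hs n).toFinset, w a := by
  rw [sizeSeries, coeff_mk, finsum_mem_eq_finite_toFinset_sum _ (hs n)]

theorem FiniteSizes.prod {α β : Type*} {s : α → ℕ} {t : β → ℕ} (hs : FiniteSizes s)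
    (ht : FiniteSizes t) : FiniteSizes fun x : α × β => s x.1 + t x.2 := by
  intro n
  refine (((Set.finite_Iic n).biUnion fun i _ => hs i).prod
    ((Set.finite_Iic n).biUnion fun i _ => ht i)).subset ?_
  rintro ⟨a, b⟩ h
  simp only [Set.mem_preimage, Set.mem_singleton_iff] at h
  simp only [Set.mem_prod, Set.mem_iUnion, Set.mem_preimage, Set.mem_singleton_iff, Set.mem_Iic,
    exists_prop]
  exact ⟨⟨s a, by omega, rfl⟩, ⟨t b, by omega, rfl⟩⟩

theorem FiniteSizes.two_mul {α : Type*} {s : α → ℕ} (hs : FiniteSizes s) :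
    FiniteSizes fun a => 2 * s a := by
  intro n
  refine (hs (n / 2)).subset fun a h => ?_
  simp only [Set.mem_preimage, Set.mem_singleton_iff] at h ⊢
  omega

theorem sizeSeries_prod {α β : Type*} {s : α → ℕ} {t : β → ℕ} (hs : FiniteSizes s)
    (ht : FiniteSizes t) (w : α → ℤ) (v : β → ℤ) :
    sizeSeries (fun x : α × β => s x.1 + t x.2) (fun x => w x.1 * v x.2) =
      sizeSeries s w * sizeSeries t v := by
  ext n
  rw [(hs.prod ht).coeff_sizeSeries, coeff_mul]
  simp only [hs.coeff_sizeSeries, ht.coeff_sizeSeries, Finset.sum_mul_sum, ← Finset.sum_product']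
  rw [← Finset.sum_fiberwise_of_maps_to (s := ((hs.prod ht) n).toFinset)
    (t := Finset.HasAntidiagonal.antidiagonal n) (g := fun x => (s x.1, t x.2))]
  · refine Finset.sum_congr rfl fun ij hij => Finset.sum_congr ?_ fun _ _ => rfl
    ext ⟨a, b⟩
    rw [Finset.HasAntidiagonal.mem_antidiagonal] at hij
    simp only [Finset.mem_filter, Set.Finite.mem_toFinset, Set.mem_preimage,
      Set.mem_singleton_iff, Finset.mem_product, Prod.ext_iff]
    omega
  · intro x hx
    simpa using hx

theorem sizeSeries_two_mul {α : Type*} (s : α → ℕ) (w : α → ℤ) :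
    sizeSeries (fun a => 2 * s a) w = expand 2 two_ne_zero (sizeSeries s w) := by
  ext n
  rw [coeff_expand]
  simp only [sizeSeries, coeff_mk]
  split_ifs with h
  · obtain ⟨m, rfl⟩ := h
    rw [Nat.mul_div_cancel_left _ two_pos,
      show (fun a => 2 * s a) ⁻¹' {2 * m} = s ⁻¹' {m} by ext a; simp]
  · exact finsum_mem_eq_zero_of_forall_eq_zero fun a ha => absurd ⟨s a, ha.symm⟩ h

theorem finiteSizes_ptn : FiniteSizes Ptn.size := fun n =>
  (finite_ptn n).subset fun _ h => le_of_eq h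

theorem finiteSizes_extPtn : FiniteSizes ExtPtn.size := fun n =>
  (finite_extPtn n).subset fun _ h => le_of_eq h

theorem sizeSeries_ptn (w : Ptn → ℤ) : sizeSeries Ptn.size w = ptnSeries w := by
  ext n
  rw [finiteSizes_ptn.coeff_sizeSeries, ptnSeries, coeff_mk]
  symm
  refine Finset.sum_bij (fun q _ => (⟨n, q⟩ : Ptn)) ?_ ?_ ?_ ?_
  · intro q _
    simp [Ptn.size]
  · intro q _ q' _ h
    simpa using h
  · rintro ⟨m, q⟩ h
    simp only [Ptn.size, Set.Finite.mem_toFinset, Set.mem_preimage, Set.mem_singleton_iff] at h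
    subst h
    exact ⟨q, Finset.mem_univ _, rfl⟩
  · intro q _
    rfl

theorem sizeSeries_extPtn (w : ExtPtn → ℤ) :
    sizeSeries ExtPtn.size w =
      ptnSeries (fun p => w (.ordinary p)) + C (w .star + w .starStar) * X := by
  classical
  ext n
  rw [finiteSizes_extPtn.coeff_sizeSeries, ← sizeSeries_ptn, map_add,
    finiteSizes_ptn.coeff_sizeSeries, coeff_C_mul, coeff_X]
  have h : (finiteSizes_extPtn n).toFinset = (finiteSizes_ptn n).toFinset.image
      ExtPtn.ordinary ∪
      if n = 1 then {ExtPtn.star, ExtPtn.starStar} else ∅ := by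
    ext e
    rcases e with p | _ | _ <;> by_cases hn : n = 1 <;>
      simp only [Finset.mem_union, Finset.mem_image, ExtPtn.ordinary.injEq, exists_eq_right] <;>
      simp [ExtPtn.size, hn, eq_comm]
  rw [h, Finset.sum_union, Finset.sum_image (by simp)]
  · congr 1
    split_ifs
    · rw [Finset.sum_pair (by simp), mul_one]
    · simp
  · rw [Finset.disjoint_left]
    intro e he
    obtain ⟨p, -, rfl⟩ := Finset.mem_image.1 he
    split_ifs <;> simp

theorem ptnSeries_one_mul_eulerSeries : eulerSeries * ptnSeries (fun _ => 1) = 1 := by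
  rw [show ptnSeries (fun _ => 1) = geomSeries fun _ => 1 by simp [geomSeries_eq_ptnSeries]]
  exact distinctSeries_mul_geomSeries fun _ => 1

theorem ptnSeries_size_eq_one (a : ℤ) :
    ptnSeries (fun p => if p.size = 1 then a else 0) = C a * X := by
  ext n
  rw [coeff_C_mul, coeff_X, ptnSeries, coeff_mk]
  simp only [Ptn.size]
  by_cases h : n = 1
  · subst h
    simp
  · simp [h]

/-- The weight -1 of the ordinary partition 1 changes the partition series by -2q, and the two extra
copies restore 2q. -/
theorem eulerSeries_mul_sizeSeries_weight :
    eulerSeries * sizeSeries ExtPtn.size ExtPtn.weight = 1 := by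
  have h : sizeSeries ExtPtn.size ExtPtn.weight = ptnSeries fun _ => 1 := by
    rw [sizeSeries_extPtn, show (fun p => ExtPtn.weight (.ordinary p)) = fun p : Ptn =>
      1 + if p.size = 1 then -2 else 0 by
        ext p; simp only [ExtPtn.weight]; split_ifs <;> rfl, ptnSeries_add, ptnSeries_size_eq_one]
    simp only [ExtPtn.weight, map_neg, map_add, map_ofNat, map_one]
    ring
  rw [h, ptnSeries_one_mul_eulerSeries]

theorem Ptn.neg_one_pow_crank_of_size_eq_one {p : Ptn} (h : p.size = 1) :
    (-1 : ℤ) ^ p.crank.natAbs = -1 := by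
  obtain ⟨n, q⟩ := p
  obtain rfl : n = 1 := h
  obtain rfl : q = default := Subsingleton.elim _ _
  have hp : Ptn.parts ⟨1, default⟩ = {1} := by simp [Ptn.parts]
  have h1 : Ptn.ones ⟨1, default⟩ = 1 := by simp [Ptn.ones, hp]
  simp [Ptn.crank, h1, hp, Multiset.filter_singleton]

/-- For the ordinary partition 1, weight -1 with modified crank 0 gives the same sign as weight 1
with its true crank -1. The two extra copies have odd crank and contribute exactly the -2q needed.
-/
theorem plusSeries_sq_mul_sizeSeries_crank :
    plusSeries ^ 2 * sizeSeries ExtPtn.size (fun e => e.weight * (-1) ^ e.crank.natAbs) =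
      eulerSeries := by
  rw [← plusSeries_sq_mul_ptnSeries_crank, sizeSeries_extPtn]
  congr 1
  rw [show (fun p => ExtPtn.weight (.ordinary p) * (-1) ^ (ExtPtn.crank (.ordinary p)).natAbs) =
    fun p : Ptn => (-1) ^ p.crank.natAbs by
      ext p
      simp only [ExtPtn.weight, ExtPtn.crank]
      split_ifs with h
      · rw [Ptn.neg_one_pow_crank_of_size_eq_one h]; rfl
      · rw [one_mul]]
  simp only [ExtPtn.weight, ExtPtn.crank]
  norm_num
  ring

/-! ### The product of seven series. -/

/-- The weight of a vector partition, counted with the parity of its crank. -/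
noncomputable def VecPtn.signedWeight (v : VecPtn) : ℤ :=
  v.weight * (-1) ^ v.crank.natAbs

theorem VecPtn.neg_one_pow_crank (v : VecPtn) :
    (-1 : ℤ) ^ v.crank.natAbs =
      (-1) ^ v.p₂.length * (-1) ^ v.p₃.length * (-1) ^ v.p₆.crank.natAbs := by
  rw [← pow_add, ← pow_add]
  refine neg_one_pow_congr ?_
  simp only [VecPtn.crank]
  grind

open Classical in
/-- Partitions into distinct even parts. -/
theorem ptnSeries_distinctEvenParts :
    ptnSeries (fun p => if p.DistinctEvenParts then (-1) ^ p.length else 0) =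
      expand 2 two_ne_zero eulerSeries := by
  rw [expand_distinctSeries _ (fun i => if Even i then -1 else 0) (by simp) (by simp),
    distinctSeries_eq_ptnSeries]
  congr 1
  ext p
  by_cases h1 : p.parts.Nodup
  · by_cases h2 : ∀ i ∈ p.parts, Even i
    · rw [if_pos ⟨h1, h2⟩, if_pos h1, Multiset.map_congr rfl fun i hi => if_pos (h2 i hi)]
      simp [Ptn.length]
    · rw [if_neg fun h => h2 h.2, if_pos h1]
      push Not at h2
      obtain ⟨i, hi, hP⟩ := h2
      exact (Multiset.prod_eq_zero (Multiset.mem_map.2 ⟨i, hi, if_neg (by simpa using hP)⟩)).symm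
  · rw [if_neg fun h => h1 h.1, if_neg h1]

open Classical in
/-- Partitions into odd parts. -/
theorem ptnSeries_oddParts (a : ℤ) :
    ptnSeries (fun p => if p.OddParts then a ^ p.length else 0) =
      geomSeries fun i => if Odd i then a else 0 := by
  rw [geomSeries_eq_ptnSeries]
  congr 1
  ext p
  by_cases h : p.OddParts
  · rw [if_pos h, Multiset.map_congr rfl fun i hi => if_pos (h i hi)]
    simp [Ptn.length]
  · rw [if_neg h]
    unfold Ptn.OddParts at h
    push Not at h
    obtain ⟨i, hi, hP⟩ := h
    exact (Multiset.prod_eq_zero (Multiset.mem_map.2 ⟨i, hi, if_neg (by simpa using hP)⟩)).symm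

open Classical in
/-- The weighted count of vector partitions as a coefficient of a product of seven series. -/
theorem sum_signedWeight_eq_coeff (n : ℕ) :
    ∑ v ∈ colored n, v.signedWeight = coeff n (
      sizeSeries Ptn.size (fun p => if p.DistinctEvenParts then (-1) ^ p.length else 0) *
      (sizeSeries Ptn.size (fun p => if p.OddParts then (-1) ^ p.length else 0) *
      (sizeSeries Ptn.size (fun p => if p.OddParts then (-1) ^ p.length else 0) *
      (sizeSeries Ptn.size (fun p => if p.OddParts then 1 ^ p.length else 0) *
      (sizeSeries Ptn.size (fun p => if p.OddParts then 1 ^ p.length else 0) *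
      (sizeSeries (fun e => 2 * ExtPtn.size e)
        (fun e => ExtPtn.weight e * (-1) ^ (ExtPtn.crank e).natAbs) *
      sizeSeries (fun e => 2 * ExtPtn.size e) ExtPtn.weight)))))) := by
  have f1 := finiteSizes_ptn
  have f2 := finiteSizes_extPtn.two_mul
  rw [← sizeSeries_prod f2 f2, ← sizeSeries_prod f1 (f2.prod f2),
    ← sizeSeries_prod f1 (f1.prod (f2.prod f2)),
    ← sizeSeries_prod f1 (f1.prod (f1.prod (f2.prod f2))),
    ← sizeSeries_prod f1 (f1.prod (f1.prod (f1.prod (f2.prod f2)))),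
    ← sizeSeries_prod f1 (f1.prod (f1.prod (f1.prod (f1.prod (f2.prod f2))))),
    (f1.prod (f1.prod (f1.prod (f1.prod (f1.prod (f2.prod f2)))))).coeff_sizeSeries]
  -- The product side ranges over all 7-tuples of size `n`; the indicators vanish on those that are
  -- not colored, so only nonzero terms are matched.
  refine Finset.sum_bij_ne_zero (fun v _ _ => (v.p₁, v.p₂, v.p₃, v.p₄, v.p₅, v.p₆, v.p₇))
    ?_ ?_ ?_ ?_
  · intro v hv _
    have h : v.size = n := ((finite_colored n).mem_toFinset.1 hv).2
    simp only [Set.Finite.mem_toFinset, Set.mem_preimage, Set.mem_singleton_iff]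
    rw [← h, VecPtn.size]
    ring
  · rintro ⟨⟩ _ _ ⟨⟩ _ _ h
    simpa using h
  · rintro ⟨a, b, c, d, e, f, g⟩ hx h0
    simp only [Set.Finite.mem_toFinset, Set.mem_preimage, Set.mem_singleton_iff] at hx
    simp only [ne_eq, mul_eq_zero, not_or, ite_eq_right_iff, not_forall, exists_prop, one_pow] at h0
    obtain ⟨⟨h1, -⟩, ⟨h2, -⟩, ⟨h3, -⟩, ⟨h4, -⟩, ⟨h5, -⟩, ⟨h6, -⟩, h7⟩ := h0
    refine ⟨⟨a, b, c, d, e, f, g⟩, ?_, ?_, rfl⟩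
    · refine (finite_colored n).mem_toFinset.2 ⟨⟨h1, h2, h3, h4, h5⟩, ?_⟩
      rw [VecPtn.size, ← hx]
      ring
    · simp [VecPtn.signedWeight, VecPtn.weight, h6, h7]
  · intro v hv _
    obtain ⟨h1, h2, h3, h4, h5⟩ := ((finite_colored n).mem_toFinset.1 hv).1
    simp only [if_pos h1, if_pos h2, if_pos h3, if_pos h4, if_pos h5]
    rw [VecPtn.signedWeight, VecPtn.weight, VecPtn.neg_one_pow_crank]
    ring

theorem sum_signedWeight (n : ℕ) :
    ∑ v ∈ colored n, v.signedWeight = coeff n (expand 2 two_ne_zero eulerSeries) := by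
  classical
  rw [sum_signedWeight_eq_coeff, sizeSeries_two_mul, sizeSeries_two_mul]
  simp only [sizeSeries_ptn, ptnSeries_distinctEvenParts, ptnSeries_oddParts]
  congr 1
  have h1 := geomSeries_odd_mul
  have h2 := congrArg (expand 2 two_ne_zero) plusSeries_sq_mul_sizeSeries_crank
  have h3 := congrArg (expand 2 two_ne_zero) eulerSeries_mul_sizeSeries_weight
  simp only [map_mul, map_pow, map_one] at h2 h3
  generalize geomSeries (fun i => if Odd i then -1 else 0) = A at *
  generalize geomSeries (fun i => if Odd i then 1 else 0) = B at *
  -- Now (A B)² S(q²) = E(q²) and E(q²) W(q²) = 1, so the product collapses to E(q²).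
  rw [← h1] at h2
  linear_combination (expand 2 two_ne_zero eulerSeries *
    expand 2 two_ne_zero (sizeSeries ExtPtn.size ExtPtn.weight)) * h2 +
    expand 2 two_ne_zero eulerSeries * h3

/-! ### Parity counts and pentagonal coefficients. -/

theorem evenCount_sub_oddCount (n : ℕ) :
    evenCount n - oddCount n = ∑ v ∈ colored n, v.signedWeight := by
  rw [evenCount, oddCount, Finset.sum_filter, Finset.sum_filter, ← Finset.sum_sub_distrib]
  refine Finset.sum_congr rfl fun v _ => ?_
  rw [VecPtn.signedWeight]
  by_cases h : Even v.crank
  · rw [if_pos h, if_neg (by simpa using h), (Int.natAbs_even.2 h).neg_one_pow]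
    ring
  · have h' := Int.not_even_iff_odd.1 h
    rw [if_neg h, if_pos h', (Int.natAbs_odd.2 h').neg_one_pow]
    ring

theorem paritySum_eq (n : ℕ) : paritySum n = ∑ v ∈ colored n, v.signedWeight := by
  rw [paritySum, finsum_eq_sum_of_support_subset (s := (colored n).image VecPtn.crank)]
  · simp only [crankCount]
    rw [← Finset.sum_fiberwise_of_maps_to (g := VecPtn.crank)
      fun v hv => Finset.mem_image_of_mem VecPtn.crank hv]
    refine Finset.sum_congr rfl fun m _ => ?_
    rw [Finset.mul_sum]
    refine Finset.sum_congr rfl fun v hv => ?_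
    rw [VecPtn.signedWeight, (Finset.mem_filter.1 hv).2, mul_comm]
  · intro m hm
    obtain ⟨v, hv, -⟩ := Finset.exists_ne_zero_of_sum_ne_zero (right_ne_zero_of_mul hm)
    rw [Finset.mem_filter] at hv
    exact Finset.mem_coe.2 (Finset.mem_image.2 ⟨v, hv.1, hv.2⟩)

theorem coeff_expand_eulerSeries {n : ℕ} {m : ℤ} (h : (n : ℤ) = m * (3 * m - 1)) :
    coeff n (expand 2 two_ne_zero eulerSeries) = (-1) ^ m.natAbs := by
  rw [← two_mul_natCast_pentagonal] at h
  obtain rfl : n = 2 * pentagonal m := by exact_mod_cast h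
  rw [coeff_expand_mul, eulerSeries_eq_pentagonalSeries, coeff_pentagonalSeries_pentagonal]
  rcases Int.even_or_odd m with hm | hm
  · rw [Int.negOnePow_even _ hm, (Int.natAbs_even.2 hm).neg_one_pow]
    simp
  · rw [Int.negOnePow_odd _ hm, (Int.natAbs_odd.2 hm).neg_one_pow]
    simp

theorem coeff_expand_eulerSeries_eq_zero {n : ℕ}
    (h : ¬ ∃ m : ℤ, (n : ℤ) = m * (3 * m - 1)) :
    coeff n (expand 2 two_ne_zero eulerSeries) = 0 := by
  rw [coeff_expand]
  split_ifs with h2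
  · obtain ⟨k, rfl⟩ := h2
    rw [Nat.mul_div_cancel_left _ two_pos, eulerSeries_eq_pentagonalSeries]
    refine coeff_pentagonalSeries_eq_zero _ ?_
    rintro ⟨m, rfl⟩
    exact h ⟨m, by rw [← two_mul_natCast_pentagonal]; push_cast; rfl⟩
  · rfl

end SevenColored

theorem mainTheorem10 (n : ℕ) :
    SevenColored.paritySum n = SevenColored.evenCount n - SevenColored.oddCount n ∧
    (∀ m : ℤ, ((n : ℤ) = m * (3 * m + 1) ∨ (n : ℤ) = m * (3 * m - 1)) →
      SevenColored.evenCount n - SevenColored.oddCount n = (-1) ^ m.natAbs) ∧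
    ((¬ ∃ m : ℤ, (n : ℤ) = m * (3 * m + 1) ∨ (n : ℤ) = m * (3 * m - 1)) →
      SevenColored.evenCount n - SevenColored.oddCount n = 0) := by
  rw [SevenColored.paritySum_eq, SevenColored.evenCount_sub_oddCount,
    SevenColored.sum_signedWeight]
  refine ⟨rfl, ?_, fun h => ?_⟩
  · rintro m (h | h)
    · rw [← Int.natAbs_neg]
      exact SevenColored.coeff_expand_eulerSeries (by rw [h]; ring)
    · exact SevenColored.coeff_expand_eulerSeries h
  · exact SevenColored.coeff_expand_eulerSeries_eq_zero fun ⟨m, hm⟩ => h ⟨m, Or.inr hm⟩
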